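/- A 4-spectrum is a list of four complex numbers, repetitions allowed. A list $\sigma$ is realizable if it is the list of eigenvalues (with algebraic multiplicity) of an entrywise nonnegative matrix, and irreducibly realizable if it is the list of eigenvalues of an irreducible entrywise nonnegative matrix, that is, one that is not similar by a permutation matrix to a nontrivially block triangular matrix. Let $\rho(\sigma)$ be the largest absolute value of an element of $\sigma$. The list $\sigma$ is spectrally simple if $\rho(\sigma)$ is, counting multiplicity, the only element of $\sigma$ on the circle $|z|=\rho(\sigma)$. A list $\sigma$ that is not spectrally simple, is closed under complex conjugation (with multiplicity), has nonnegative sum and contains $\rho=\rho(\sigma)$ has Frobenius structure if $\rho>0$ and, for some integers $h>1$, $p\ge 0$, $m\ge 1$ and nonzero complex numbers $z_2,\dots,z_m$ with $|z_j|<1$, $$\prod_{\lambda\in\sigma}(x-\lambda)=x^p\,(x^h-\rho^h)\,(x^h-(z_2\rho)^h)\cdots(x^h-(z_m\rho)^h).$$ Theorem. Let $\sigma$ be a realizable list of four real numbers. Then exactly one of the following holds: (i) $\sigma$ is irreducibly realizable; (ii) $\sigma$ is not spectrally simple and does not have Frobenius structure. -/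

import Mathlib

namespace NIEP

open Polynomial

/-- The list of eigenvalues of a real square matrix, as a multiset of complex numbers
(repetitions according to algebraic multiplicity). -/
noncomputable def matrixSpectrum {n : ℕ} (A : Matrix (Fin n) (Fin n) ℝ) : Multiset ℂ :=
  (A.map (algebraMap ℝ ℂ)).charpoly.roots

/-- `A` is reducible: permuting rows and columns simultaneously makes it block triangular with
two nonempty square diagonal blocks, of sizes `k` and `n - k`. -/
def IsReducible {n : ℕ} (A : Matrix (Fin n) (Fin n) ℝ) : Prop :=
  ∃ (π : Equiv.Perm (Fin n)) (k : ℕ), 0 < k ∧ k < n ∧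
    ∀ i j : Fin n, k ≤ (i : ℕ) → (j : ℕ) < k → A (π i) (π j) = 0

/-- `σ` is the spectrum of an entrywise nonnegative matrix.
(The size of the matrix is necessarily the number of elements of `σ`.) -/
def IsRealizable (σ : Multiset ℂ) : Prop :=
  ∃ (n : ℕ) (A : Matrix (Fin n) (Fin n) ℝ), (∀ i j, 0 ≤ A i j) ∧ matrixSpectrum A = σ

/-- `σ` is the spectrum of an irreducible entrywise nonnegative matrix. -/
def IsIrreduciblyRealizable (σ : Multiset ℂ) : Prop :=
  ∃ (n : ℕ) (A : Matrix (Fin n) (Fin n) ℝ),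
    (∀ i j, 0 ≤ A i j) ∧ ¬ IsReducible A ∧ matrixSpectrum A = σ

/-- `ρ(σ)`: the largest absolute value of an element of `σ`. -/
noncomputable def perronRoot (σ : Multiset ℂ) : ℝ :=
  ((σ.map (fun z => ‖z‖₊)).sup : NNReal)

/-- `σ` is spectrally simple: `ρ(σ)` is the only element of `σ`, counted with multiplicity,
on the circle of radius `ρ(σ)`. -/
noncomputable def IsSpectrallySimple (σ : Multiset ℂ) : Prop :=
  σ.filter (fun z => ‖z‖ = perronRoot σ) = {(perronRoot σ : ℂ)}

/-- `σ` has Frobenius structure: it satisfies the trace, reality and Perron conditions, is not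
spectrally simple, `ρ = ρ(σ)` is positive, and for some `h > 1` the monic polynomial with list of
roots `σ` is `x ^ p * (x ^ h - ρ ^ h) * (x ^ h - (z₂ ρ) ^ h) * ⋯ * (x ^ h - (z_m ρ) ^ h)`
with `0 < |z_j| < 1`; here `Z` is the list `z₂, …, z_m`, possibly empty. -/
noncomputable def HasFrobeniusStructure (σ : Multiset ℂ) : Prop :=
  0 ≤ σ.sum.re ∧
  σ.map (starRingEnd ℂ) = σ ∧
  (perronRoot σ : ℂ) ∈ σ ∧
  ¬ IsSpectrallySimple σ ∧
  0 < perronRoot σ ∧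
  ∃ (h p : ℕ) (Z : Multiset ℂ), 1 < h ∧ (∀ z ∈ Z, z ≠ 0 ∧ ‖z‖ < 1) ∧
    (σ.map (fun z => X - C z)).prod =
      X ^ p * (X ^ h - C ((perronRoot σ : ℂ) ^ h)) *
        (Z.map (fun z => X ^ h - C ((z * (perronRoot σ : ℂ)) ^ h))).prod

end NIEP

/-!
Let `A` be an irreducible nonnegative matrix. Among all `r` admitting a positive vector `x` with
`A x ≤ r x` there is a least one, by compactness; there `A x = r x`, since otherwise solving
`A u = r u + 1` yields a positive vector `-u` with a smaller value. Comparing other vectors with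
`x` at a coordinate where the ratio is largest (a maximum principle) shows that `r` is a simple
eigenvalue and dominates all others, and that if another eigenvalue has modulus `r` then the
diagonal of `A` vanishes. Hence an irreducibly realizable list which is not spectrally simple
contains its Perron root once and has sum zero, and the same is true of a list with Frobenius
structure; for four real numbers this leaves only `ρ, -ρ, a, -a` with `|a| < ρ`, which has Frobenius
structure and is irreducibly realizable.

A block matrix `[[B, C], [C, B]]` has the eigenvalues of `B + C` together with those of `B - C`.
With suitable `2 × 2` blocks this realizes `ρ, -ρ, a, -a`, and also every spectrally simple real
list containing its Perron root and having nonnegative sum.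
-/

namespace NIEP

open Matrix Polynomial

section Indecomposable

variable {m R : Type*}

/-- `A` is indecomposable: in the digraph with an arc from `i` to `j` whenever `A i j ≠ 0`, every
nonempty proper set of vertices has an arc leaving it. This is the permutation-free form of
`¬ IsReducible A`; unlike `Matrix.IsIrreducible`, it holds for the zero `1 × 1` matrix. -/
def IsIndecomposable [Zero R] (A : Matrix m m R) : Prop :=
  ∀ S : Set m, S.Nonempty → Sᶜ.Nonempty → ∃ i ∈ S, ∃ j ∉ S, A i j ≠ 0

lemma isIndecomposable_of_not_isReducible {n : ℕ} {A : Matrix (Fin n) (Fin n) ℝ}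
    (hA : ¬ IsReducible A) : IsIndecomposable A := by
  classical
  rintro S ⟨a, ha⟩ ⟨b, hb⟩
  by_contra! hclosed
  apply hA
  let T : Finset (Fin n) := {i | i ∉ S}
  have hT : T.card < n := by
    simpa using Finset.card_lt_card (Finset.ssubset_univ_iff.2 fun h : T = Finset.univ =>
      (by simpa [T] using h.ge (Finset.mem_univ a) : a ∉ S) ha)
  have hcard : Fintype.card {i : Fin n // (i : ℕ) < T.card} = Fintype.card {i // i ∉ S} := by
    rw [Fintype.card_subtype, Fintype.card_subtype]
    exact Fin.card_filter_val_lt.trans (min_eq_right hT.le)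
  let e := Fintype.equivOfCardEq hcard
  refine ⟨e.extendSubtype, T.card, Finset.card_pos.2 ⟨b, by simpa [T] using hb⟩, hT, ?_⟩
  intro i j hi hj
  refine hclosed _ ?_ _ (e.extendSubtype_mem j hj)
  simpa only [not_not] using e.extendSubtype_not_mem i hi.not_gt

lemma IsIndecomposable.not_isReducible {n : ℕ} {A : Matrix (Fin n) (Fin n) ℝ}
    (hA : IsIndecomposable A) : ¬ IsReducible A := by
  rintro ⟨π, k, hk, hkn, hblock⟩
  obtain ⟨i, hi, j, hj, hij⟩ := hA {i | k ≤ (π.symm i : ℕ)}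
    ⟨π ⟨k, hkn⟩, by simp⟩ ⟨π ⟨0, by omega⟩, by simpa using hk.ne'⟩
  exact hij (by simpa using hblock (π.symm i) (π.symm j) hi (not_le.1 hj))

open Fin.CommRing in
lemma isIndecomposable_of_apply_add_one_ne_zero [Zero R] {n : ℕ} [NeZero n]
    {A : Matrix (Fin n) (Fin n) R} (hA : ∀ i, A i (i + 1) ≠ 0) : IsIndecomposable A := by
  rintro S ⟨i, hi⟩ ⟨j, hj⟩
  by_contra! hclosed
  have hmem : ∀ k : ℕ, i + (k : Fin n) ∈ S := by
    intro k
    induction k with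
    | zero => simpa using hi
    | succ k ih =>
      by_contra hk
      refine hA _ (hclosed _ ih _ ?_)
      rwa [add_assoc, ← Nat.cast_succ]
  exact hj (by simpa using hmem (j - i : Fin n).val)

variable [Fintype m] [Field R] [LinearOrder R] [IsStrictOrderedRing R] {A : Matrix m m R}

lemma pos_of_mulVec_le_smul (hA : ∀ i j, 0 ≤ A i j) (hirr : IsIndecomposable A) {x : m → R}
    (hx : 0 ≤ x) (hx0 : x ≠ 0) {c : R} (h : A *ᵥ x ≤ c • x) (i : m) : 0 < x i := by
  by_contra! hi
  obtain ⟨k, hk⟩ := Function.ne_iff.1 hx0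
  obtain ⟨a, ha, b, hb, hab⟩ := hirr {i | x i = 0} ⟨i, hi.antisymm (hx i)⟩ ⟨k, hk⟩
  have hpos : 0 < (A *ᵥ x) a := Finset.sum_pos' (fun j _ => mul_nonneg (hA a j) (hx j))
    ⟨b, Finset.mem_univ b, mul_pos ((hA a b).lt_of_ne' hab) ((hx b).lt_of_ne' hb)⟩
  have hle : (A *ᵥ x) a ≤ c * x a := h a
  rw [show x a = 0 from ha, mul_zero] at hle
  exact hpos.not_ge hle

lemma eq_of_le_of_apply_eq (hA : ∀ i j, 0 ≤ A i j) (hirr : IsIndecomposable A) {r : R}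
    {u v : m → R} (hu : r • u ≤ A *ᵥ u) (hv : A *ᵥ v ≤ r • v) (huv : u ≤ v) {k : m}
    (hk : u k = v k) : u = v := by
  by_contra hne
  have hpos := pos_of_mulVec_le_smul hA hirr (sub_nonneg.2 huv) (sub_ne_zero.2 (Ne.symm hne))
    (c := r) (by simpa only [mulVec_sub, smul_sub] using sub_le_sub hv hu) k
  rw [Pi.sub_apply, hk, sub_self] at hpos
  exact hpos.false

omit [Fintype m] in
lemma exists_le_smul_and_apply_eq [Finite m] [Nonempty m] {x : m → R} (hx : ∀ i, 0 < x i)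
    (u : m → R) : ∃ c : R, u ≤ c • x ∧ ∃ k, u k = c * x k := by
  obtain ⟨k, hk⟩ := Finite.exists_max fun i => u i / x i
  exact ⟨u k / x k, fun i => (div_le_iff₀ (hx i)).1 (hk i), k, (div_mul_cancel₀ _ (hx k).ne').symm⟩

lemma exists_nonneg_smul_eq_of_smul_le_mulVec (hA : ∀ i j, 0 ≤ A i j)
    (hirr : IsIndecomposable A) {r : R} {x u : m → R} (hx : ∀ i, 0 < x i)
    (hrx : A *ᵥ x ≤ r • x) (hu : r • u ≤ A *ᵥ u) {i : m} (hi : 0 ≤ u i) :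
    ∃ c : R, 0 ≤ c ∧ c • x = u := by
  have : Nonempty m := ⟨i⟩
  obtain ⟨c, hle, k, hk⟩ := exists_le_smul_and_apply_eq hx u
  have hc : 0 ≤ c := nonneg_of_mul_nonneg_left (hi.trans (hle i)) (hx i)
  refine ⟨c, hc, (eq_of_le_of_apply_eq hA hirr hu ?_ hle hk).symm⟩
  rw [mulVec_smul, smul_comm]
  exact smul_le_smul_of_nonneg_left hrx hc

lemma exists_smul_eq_of_smul_le_mulVec [Nonempty m] (hA : ∀ i j, 0 ≤ A i j)
    (hirr : IsIndecomposable A) {r : R} {x u : m → R} (hx : ∀ i, 0 < x i) (hrx : A *ᵥ x = r • x)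
    (hu : r • u ≤ A *ᵥ u) : ∃ c : R, c • x = u := by
  obtain ⟨c, hle, k, hk⟩ := exists_le_smul_and_apply_eq hx u
  refine ⟨c, (eq_of_le_of_apply_eq hA hirr hu ?_ hle hk).symm⟩
  rw [mulVec_smul, hrx, smul_comm]

lemma mulVec_eq_smul_of_mulVec_le_smul (hA : ∀ i j, 0 ≤ A i j) (hirr : IsIndecomposable A) {r : R}
    {x u : m → R} (hx : ∀ i, 0 < x i) (hrx : A *ᵥ x ≤ r • x) (hu0 : u ≠ 0)
    (hu : A *ᵥ u = r • u) : A *ᵥ x = r • x := by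
  obtain ⟨i, -⟩ := Function.ne_iff.1 hu0
  wlog hi : 0 ≤ u i generalizing u
  · exact this (neg_ne_zero.2 hu0) (by rw [mulVec_neg, hu, smul_neg])
      (neg_nonneg.2 (not_le.1 hi).le)
  obtain ⟨c, -, rfl⟩ := exists_nonneg_smul_eq_of_smul_le_mulVec hA hirr hx hrx hu.ge hi
  rw [mulVec_smul, smul_comm] at hu
  exact smul_right_injective _ (smul_ne_zero_iff.1 hu0).1 hu

lemma neg_of_mulVec_eq_smul_add_one (hA : ∀ i j, 0 ≤ A i j) (hirr : IsIndecomposable A) {r : R}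
    {x u : m → R} (hx : ∀ i, 0 < x i) (hrx : A *ᵥ x ≤ r • x) (hu : A *ᵥ u = r • u + 1) (i : m) :
    u i < 0 := by
  by_contra! hi
  obtain ⟨c, hc, rfl⟩ := exists_nonneg_smul_eq_of_smul_le_mulVec hA hirr hx hrx
    (hu ▸ le_add_of_nonneg_right zero_le_one) hi
  have hle : A *ᵥ (c • x) ≤ r • (c • x) := by
    rw [mulVec_smul, smul_comm r]
    exact smul_le_smul_of_nonneg_left hrx hc
  rw [hu] at hle
  exact one_pos.not_ge (le_of_add_le_add_left ((hle i).trans_eq (add_zero _).symm))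

end Indecomposable

lemma exists_mulVec_eq_smul_or_exists_mulVec_eq_smul_add {m K : Type*} [Fintype m] [Field K]
    (A : Matrix m m K) (r : K) (b : m → K) :
    (∃ u ≠ 0, A *ᵥ u = r • u) ∨ ∃ u, A *ᵥ u = r • u + b := by
  classical
  have hsub : ∀ u, (A - r • (1 : Matrix m m K)) *ᵥ u = A *ᵥ u - r • u := fun u => by
    rw [sub_mulVec, smul_mulVec, one_mulVec]
  by_cases hdet : (A - r • (1 : Matrix m m K)).det = 0
  · obtain ⟨u, hu0, hu⟩ := exists_mulVec_eq_zero_iff.2 hdet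
    exact Or.inl ⟨u, hu0, sub_eq_zero.1 (hsub u ▸ hu)⟩
  · obtain ⟨u, hu⟩ := mulVec_surjective_iff_isUnit.2
      ((isUnit_iff_isUnit_det _).2 (isUnit_iff_ne_zero.2 hdet)) b
    exact Or.inr ⟨u, sub_eq_iff_eq_add'.1 (hsub u ▸ hu)⟩

lemma rootMultiplicity_charpoly_eq_one {K V : Type*} [Field K] [AddCommGroup V] [Module K V]
    [FiniteDimensional K V] {f : Module.End K V} {μ : K} {v : V} (hv : v ≠ 0) (hfv : f v = μ • v)
    (h : ∀ y (c : K), f y = μ • y + c • v → y ∈ Submodule.span K {v}) :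
    f.charpoly.rootMultiplicity μ = 1 := by
  have hspan : f.maxGenEigenspace μ = Submodule.span K {v} := by
    refine le_antisymm (fun y hy => ?_) ?_
    · obtain ⟨k, hk⟩ := (Module.End.mem_maxGenEigenspace f μ y).1 hy
      clear hy
      induction k generalizing y with
      | zero => simp_all
      | succ k ih =>
        rw [pow_succ, Module.End.mul_apply] at hk
        obtain ⟨c, hc⟩ := Submodule.mem_span_singleton.1 (ih _ hk)
        refine h y c ?_
        simp [hc]
    · rw [Submodule.span_singleton_le_iff_mem, Module.End.mem_maxGenEigenspace]
      exact ⟨1, by simp [hfv]⟩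
  rw [← LinearMap.finrank_maxGenEigenspace_eq, hspan, finrank_span_singleton hv]

section PerronFrobenius

variable {m : Type*} [Fintype m] {A : Matrix m m ℝ}

lemma exists_least_subinvariant [Nonempty m] (hA : ∀ i j, 0 ≤ A i j)
    (hirr : IsIndecomposable A) :
    ∃ (r : ℝ) (x : m → ℝ), (∀ i, 0 < x i) ∧ A *ᵥ x ≤ r • x ∧
      ∀ (t : ℝ) (y : m → ℝ), (∀ i, 0 < y i) → A *ᵥ y ≤ t • y → r ≤ t := by
  classical
  obtain ⟨M, hM, -⟩ := exists_le_smul_and_apply_eq (x := 1) (fun _ => one_pos) (A *ᵥ (1 : m → ℝ))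
  let K : Set (ℝ × (m → ℝ)) := (Set.Icc 0 M ×ˢ stdSimplex ℝ m) ∩ {p | A *ᵥ p.2 ≤ p.1 • p.2}
  have hK : IsCompact K := (isCompact_Icc.prod (isCompact_stdSimplex ℝ m)).inter_right
    (isClosed_le (by fun_prop) (by fun_prop))
  have hnorm : ∀ t ≤ M, ∀ y : m → ℝ, (∀ i, 0 < y i) → A *ᵥ y ≤ t • y →
      (t, (∑ i, y i)⁻¹ • y) ∈ K := by
    intro t htM y hy hty
    have hs : 0 < ∑ i, y i := Finset.sum_pos (fun i _ => hy i) Finset.univ_nonempty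
    have ht : 0 ≤ t := by
      obtain ⟨i⟩ := ‹Nonempty m›
      have hAy : 0 ≤ (A *ᵥ y) i := Finset.sum_nonneg fun j _ => mul_nonneg (hA i j) (hy j).le
      exact nonneg_of_mul_nonneg_left (hAy.trans (hty i)) (hy i)
    refine ⟨⟨⟨ht, htM⟩, fun i => (mul_pos (inv_pos.2 hs) (hy i)).le, ?_⟩, ?_⟩
    · simp only [Pi.smul_apply, smul_eq_mul, ← Finset.mul_sum]
      exact inv_mul_cancel₀ hs.ne'
    · change A *ᵥ _ ≤ t • _
      rw [mulVec_smul, smul_comm t]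
      exact smul_le_smul_of_nonneg_left hty (inv_pos.2 hs).le
  obtain ⟨⟨r, x⟩, ⟨⟨⟨-, hrM⟩, hx⟩, hrx⟩, hmin⟩ :=
    hK.exists_isMinOn ⟨_, hnorm M le_rfl 1 (fun _ => one_pos) hM⟩ continuous_fst.continuousOn
  have hx0 : x ≠ 0 := by
    rintro rfl
    simpa using hx.2
  refine ⟨r, x, pos_of_mulVec_le_smul hA hirr hx.1 hx0 hrx, hrx, fun t y hy hty => ?_⟩
  rcases le_total t M with htM | hMt
  · exact hmin (hnorm t htM y hy hty)
  · exact hrM.trans hMt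

lemma exists_perron_vector [Nonempty m] (hA : ∀ i j, 0 ≤ A i j) (hirr : IsIndecomposable A) :
    ∃ (r : ℝ) (x : m → ℝ), (∀ i, 0 < x i) ∧ A *ᵥ x = r • x := by
  obtain ⟨r, x, hx, hrx, hmin⟩ := exists_least_subinvariant hA hirr
  refine ⟨r, x, hx, ?_⟩
  rcases exists_mulVec_eq_smul_or_exists_mulVec_eq_smul_add A r 1 with ⟨u, hu0, hu⟩ | ⟨u, hu⟩
  · exact mulVec_eq_smul_of_mulVec_le_smul hA hirr hx hrx hu0 hu
  -- `-u` is positive with `A (-u) < r (-u)` in every coordinate, so `r` was not the least value.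
  have hpos : ∀ i, 0 < (-u) i := fun i =>
    neg_pos.2 (neg_of_mulVec_eq_smul_add_one hA hirr hx hrx hu i)
  obtain ⟨t, hle, k, hk⟩ := exists_le_smul_and_apply_eq hpos (A *ᵥ (-u))
  have hrt : r * (-u) k ≤ (A *ᵥ (-u)) k :=
    hk ▸ mul_le_mul_of_nonneg_right (hmin t _ hpos hle) (hpos k).le
  rw [mulVec_neg, hu] at hrt
  simp only [Pi.neg_apply, Pi.add_apply, Pi.smul_apply, smul_eq_mul, Pi.one_apply] at hrt
  linarith

lemma rootMultiplicity_charpoly_perron [DecidableEq m] [Nonempty m] (hA : ∀ i j, 0 ≤ A i j)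
    (hirr : IsIndecomposable A) {r : ℝ} {x : m → ℝ} (hx : ∀ i, 0 < x i) (hrx : A *ᵥ x = r • x) :
    A.charpoly.rootMultiplicity r = 1 := by
  have hx0 : x ≠ 0 := fun h => (hx (Classical.arbitrary m)).ne' (congrFun h _)
  rw [← charpoly_toLin']
  refine rootMultiplicity_charpoly_eq_one hx0 (by simpa using hrx) fun y c hy => ?_
  rw [toLin'_apply] at hy
  wlog hc : 0 ≤ c generalizing y c
  · rw [← neg_mem_iff]
    refine this (-y) (-c) ?_ (neg_nonneg.2 (not_le.1 hc).le)
    rw [mulVec_neg, hy, smul_neg, neg_smul, neg_add]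
  refine Submodule.mem_span_singleton.2 (exists_smul_eq_of_smul_le_mulVec hA hirr hx hrx ?_)
  rw [hy]
  exact le_add_of_nonneg_right fun i => mul_nonneg hc (hx i).le

variable {μ : ℂ} {y : m → ℂ}

lemma smul_norm_le_mulVec_norm (hA : ∀ i j, 0 ≤ A i j) (hy : A.map (↑) *ᵥ y = μ • y) :
    ‖μ‖ • (‖y ·‖) ≤ A *ᵥ (‖y ·‖) := by
  intro i
  calc ‖μ‖ * ‖y i‖ = ‖∑ j, (A i j : ℂ) * y j‖ := by
        rw [← norm_mul]
        exact congrArg norm (congrFun hy i).symm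
    _ ≤ ∑ j, ‖(A i j : ℂ) * y j‖ := norm_sum_le _ _
    _ = ∑ j, A i j * ‖y j‖ := by
        simp only [norm_mul, Complex.norm_of_nonneg (hA i _)]

lemma norm_le_of_mulVec_le_smul (hA : ∀ i j, 0 ≤ A i j) {r : ℝ} {x : m → ℝ}
    (hx : ∀ i, 0 < x i) (hrx : A *ᵥ x ≤ r • x) (hy : A.map (↑) *ᵥ y = μ • y) (hy0 : y ≠ 0) :
    ‖μ‖ ≤ r := by
  obtain ⟨i, hi⟩ := Function.ne_iff.1 hy0
  have : Nonempty m := ⟨i⟩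
  obtain ⟨c, hle, k, hk⟩ := exists_le_smul_and_apply_eq hx (‖y ·‖)
  have hc : 0 < c := pos_of_mul_pos_left ((norm_pos_iff.2 hi).trans_le (hle i)) (hx i).le
  refine le_of_mul_le_mul_right ?_ (mul_pos hc (hx k))
  calc ‖μ‖ * (c * x k) = ‖μ‖ * ‖y k‖ := by rw [hk]
    _ ≤ (A *ᵥ (‖y ·‖)) k := smul_norm_le_mulVec_norm hA hy k
    _ ≤ (A *ᵥ (c • x)) k := Finset.sum_le_sum fun j _ => mul_le_mul_of_nonneg_left (hle j) (hA k j)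
    _ = c * (A *ᵥ x) k := by rw [mulVec_smul]; rfl
    _ ≤ c * (r * x k) := mul_le_mul_of_nonneg_left (hrx k) hc.le
    _ = r * (c * x k) := by ring

lemma norm_sub_diag_le (hA : ∀ i j, 0 ≤ A i j) {r : ℝ}
    (hr : A *ᵥ (‖y ·‖) = r • (‖y ·‖)) (hy : A.map (↑) *ᵥ y = μ • y) {i : m} (hi : y i ≠ 0) :
    ‖μ - A i i‖ ≤ r - A i i := by
  classical
  refine le_of_mul_le_mul_right ?_ (norm_pos_iff.2 hi)
  have hμi : ∑ j ∈ Finset.univ.erase i, (A i j : ℂ) * y j = (μ - A i i) * y i := by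
    rw [Finset.sum_erase_eq_sub (Finset.mem_univ i), sub_mul]
    exact congrArg (· - _) (congrFun hy i)
  have hri : ∑ j ∈ Finset.univ.erase i, A i j * ‖y j‖ = (r - A i i) * ‖y i‖ := by
    rw [Finset.sum_erase_eq_sub (Finset.mem_univ i), sub_mul]
    exact congrArg (· - _) (congrFun hr i)
  rw [← norm_mul, ← hμi, ← hri]
  refine (norm_sum_le _ _).trans_eq (Finset.sum_congr rfl fun j _ => ?_)
  rw [norm_mul, Complex.norm_of_nonneg (hA i j)]

lemma eq_norm_of_norm_sub_le {a : ℝ} (ha : 0 < a) (h : ‖μ - a‖ ≤ ‖μ‖ - a) : μ = ‖μ‖ := by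
  have hsq : ‖μ - a‖ ^ 2 = ‖μ‖ ^ 2 - 2 * a * μ.re + a ^ 2 := by
    simp only [Complex.sq_norm, Complex.normSq_apply, Complex.sub_re, Complex.sub_im,
      Complex.ofReal_re, Complex.ofReal_im]
    ring
  have hre : ‖μ‖ ≤ μ.re := by
    have := pow_le_pow_left₀ (norm_nonneg _) h 2
    nlinarith
  exact Complex.eq_coe_norm_of_nonneg (Complex.re_eq_norm.1 ((Complex.re_le_norm μ).antisymm hre))

lemma trace_eq_zero_of_norm_eq (hA : ∀ i j, 0 ≤ A i j) (hirr : IsIndecomposable A) {r : ℝ}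
    {x : m → ℝ} (hx : ∀ i, 0 < x i) (hrx : A *ᵥ x = r • x) (hy : A.map (↑) *ᵥ y = μ • y)
    (hy0 : y ≠ 0) (hμr : ‖μ‖ = r) (hμ : μ ≠ r) : A.trace = 0 := by
  subst hμr
  obtain ⟨k, hk⟩ := Function.ne_iff.1 hy0
  have : Nonempty m := ⟨k⟩
  obtain ⟨c, hc⟩ := exists_smul_eq_of_smul_le_mulVec hA hirr hx hrx (smul_norm_le_mulVec_norm hA hy)
  have hnorm : A *ᵥ (‖y ·‖) = ‖μ‖ • (‖y ·‖) := by rw [← hc, mulVec_smul, hrx, smul_comm]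
  have hy_ne : ∀ i, y i ≠ 0 := by
    have hc0 : c ≠ 0 := by
      rintro rfl
      exact norm_ne_zero_iff.2 hk (by simpa using (congrFun hc k).symm)
    intro i
    rw [← norm_ne_zero_iff]
    exact congrFun hc i ▸ mul_ne_zero hc0 (hx i).ne'
  refine Finset.sum_eq_zero fun i _ => ?_
  by_contra hAi
  exact hμ (eq_norm_of_norm_sub_le ((hA i i).lt_of_ne' hAi)
    (norm_sub_diag_le hA hnorm hy (hy_ne i)))

end PerronFrobenius

section Spectrum

variable {n : ℕ} {A : Matrix (Fin n) (Fin n) ℝ}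

lemma count_matrixSpectrum (A : Matrix (Fin n) (Fin n) ℝ) (μ : ℝ) :
    (matrixSpectrum A).count (μ : ℂ) = A.charpoly.rootMultiplicity μ := by
  rw [matrixSpectrum, Matrix.charpoly_map, count_roots]
  exact (eq_rootMultiplicity_map (algebraMap ℝ ℂ).injective μ).symm

lemma sum_matrixSpectrum (A : Matrix (Fin n) (Fin n) ℝ) :
    (matrixSpectrum A).sum = (A.trace : ℂ) := by
  rw [matrixSpectrum, ← trace_eq_sum_roots_charpoly]
  exact (AddMonoidHom.map_trace (algebraMap ℝ ℂ) A).symm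

lemma card_matrixSpectrum (A : Matrix (Fin n) (Fin n) ℝ) : (matrixSpectrum A).card = n := by
  rw [matrixSpectrum, splits_iff_card_roots.1 (IsAlgClosed.splits _), charpoly_natDegree_eq_dim,
    Fintype.card_fin]

lemma exists_mulVec_eq_smul_of_mem_matrixSpectrum {μ : ℂ} (hμ : μ ∈ matrixSpectrum A) :
    ∃ y : Fin n → ℂ, y ≠ 0 ∧ A.map (↑) *ᵥ y = μ • y := by
  have hroot : (A.map (algebraMap ℝ ℂ)).toLin'.charpoly.IsRoot μ := by
    rw [charpoly_toLin']
    exact isRoot_of_mem_roots hμ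
  obtain ⟨y, hy⟩ :=
    ((Module.End.hasEigenvalue_iff_isRoot_charpoly _ μ).2 hroot).exists_hasEigenvector
  exact ⟨y, hy.2, hy.apply_eq_smul⟩

lemma matrixSpectrum_eq_map_of_charpoly_eq {s : Multiset ℝ}
    (h : A.charpoly = (s.map (X - C ·)).prod) : matrixSpectrum A = s.map (↑) := by
  have hsplits : A.charpoly.Splits := by
    rw [h]
    refine Splits.multisetProd fun p hp => ?_
    obtain ⟨t, -, rfl⟩ := Multiset.mem_map.1 hp
    exact Splits.X_sub_C t
  rw [matrixSpectrum, Matrix.charpoly_map, hsplits.roots_map, h, roots_multiset_prod_X_sub_C]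
  rfl

lemma IsRealizable.sum_re_nonneg {σ : Multiset ℂ} (h : IsRealizable σ) : 0 ≤ σ.sum.re := by
  obtain ⟨n, A, hA, rfl⟩ := h
  rw [sum_matrixSpectrum, Complex.ofReal_re]
  exact Finset.sum_nonneg fun i _ => hA i i

end Spectrum

section PerronRoot

variable {σ : Multiset ℂ}

lemma perronRoot_nonneg (σ : Multiset ℂ) : 0 ≤ perronRoot σ := NNReal.coe_nonneg _

lemma norm_le_perronRoot {z : ℂ} (hz : z ∈ σ) : ‖z‖ ≤ perronRoot σ :=
  NNReal.coe_le_coe.2 (Multiset.le_sup (Multiset.mem_map_of_mem (‖·‖₊) hz))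

lemma perronRoot_eq_of_mem {r : ℝ} (hr : 0 ≤ r) (hmem : (r : ℂ) ∈ σ) (hle : ∀ z ∈ σ, ‖z‖ ≤ r) :
    perronRoot σ = r := by
  refine le_antisymm ?_ ((Complex.norm_of_nonneg hr).ge.trans (norm_le_perronRoot hmem))
  lift r to NNReal using hr
  refine NNReal.coe_le_coe.2 (Multiset.sup_le.2 fun b hb => ?_)
  obtain ⟨z, hz, rfl⟩ := Multiset.mem_map.1 hb
  exact hle z hz

lemma isSpectrallySimple_iff : IsSpectrallySimple σ ↔
    σ.count (perronRoot σ : ℂ) = 1 ∧ ∀ z ∈ σ, ‖z‖ = perronRoot σ → z = perronRoot σ := by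
  have hcount : (σ.filter (‖·‖ = perronRoot σ)).count (perronRoot σ : ℂ) =
      σ.count (perronRoot σ : ℂ) :=
    Multiset.count_filter_of_pos (Complex.norm_of_nonneg (perronRoot_nonneg σ))
  rw [IsSpectrallySimple, ← hcount]
  constructor
  · intro h
    refine ⟨by rw [h, Multiset.count_singleton_self], fun z hz hzρ => ?_⟩
    exact Multiset.mem_singleton.1 (h ▸ Multiset.mem_filter.2 ⟨hz, hzρ⟩)
  · rintro ⟨hone, huniq⟩
    have heq : ∀ z ∈ σ.filter (‖·‖ = perronRoot σ), (perronRoot σ : ℂ) = z := fun z hz =>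
      (huniq z (Multiset.mem_filter.1 hz).1 (Multiset.mem_filter.1 hz).2).symm
    rw [Multiset.count_eq_card.2 heq] at hone
    exact (Multiset.eq_replicate.2 ⟨hone, fun z hz => (heq z hz).symm⟩).trans
      (Multiset.replicate_one _)

theorem IsIrreduciblyRealizable.count_perronRoot_and_sum_eq_zero (h : IsIrreduciblyRealizable σ)
    (h0 : σ ≠ 0) :
    σ.count (perronRoot σ : ℂ) = 1 ∧ (¬ IsSpectrallySimple σ → σ.sum = 0) := by
  obtain ⟨n, A, hA, hred, rfl⟩ := h
  have hirr := isIndecomposable_of_not_isReducible hred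
  have : Nonempty (Fin n) := by
    rw [← Fin.pos_iff_nonempty, ← card_matrixSpectrum A]
    exact Multiset.card_pos.2 h0
  obtain ⟨r, x, hx, hrx⟩ := exists_perron_vector hA hirr
  have hcount : (matrixSpectrum A).count (r : ℂ) = 1 := by
    rw [count_matrixSpectrum, rootMultiplicity_charpoly_perron hA hirr hx hrx]
  have hmem : (r : ℂ) ∈ matrixSpectrum A := Multiset.one_le_count_iff_mem.1 hcount.ge
  have hle : ∀ z ∈ matrixSpectrum A, ‖z‖ ≤ r := fun z hz => by
    obtain ⟨y, hy0, hy⟩ := exists_mulVec_eq_smul_of_mem_matrixSpectrum hz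
    exact norm_le_of_mulVec_le_smul hA hx hrx.le hy hy0
  have hρ : perronRoot (matrixSpectrum A) = r :=
    perronRoot_eq_of_mem ((norm_nonneg _).trans (hle _ hmem)) hmem hle
  rw [isSpectrallySimple_iff, hρ]
  refine ⟨hcount, fun hns => ?_⟩
  obtain ⟨z, hz, hzr, hne⟩ : ∃ z ∈ matrixSpectrum A, ‖z‖ = r ∧ z ≠ r := by
    by_contra! huniq
    exact hns ⟨hcount, huniq⟩
  obtain ⟨y, hy0, hy⟩ := exists_mulVec_eq_smul_of_mem_matrixSpectrum hz
  rw [sum_matrixSpectrum, trace_eq_zero_of_norm_eq hA hirr hx hrx hy hy0 hzr hne,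
    Complex.ofReal_zero]

end PerronRoot

section FrobeniusStructure

lemma nextCoeff_X_pow_sub_C {R : Type*} [Ring R] [Nontrivial R] {h : ℕ} (hh : 1 < h) (c : R) :
    (X ^ h - C c).nextCoeff = 0 := by
  have hdeg : (X ^ h - C c).natDegree = h := natDegree_X_pow_sub_C
  rw [nextCoeff_of_natDegree_pos (by omega), hdeg, coeff_sub, coeff_X_pow, coeff_C,
    if_neg (by omega), if_neg (by omega), sub_zero]

lemma rootMultiplicity_X_pow_sub_C {K : Type*} [Field K] [CharZero K] {h : ℕ} (hh : h ≠ 0) {r : K}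
    (hr : r ≠ 0) : (X ^ h - C (r ^ h)).rootMultiplicity r = 1 := by
  classical
  have hne : X ^ h - C (r ^ h) ≠ 0 := (monic_X_pow_sub_C _ hh).ne_zero
  have hsep : (X ^ h - C (r ^ h)).Separable :=
    separable_X_pow_sub_C _ (Nat.cast_ne_zero.2 hh) (pow_ne_zero h hr)
  rw [← count_roots]
  exact Multiset.count_eq_one_of_mem (nodup_roots hsep) ((mem_roots hne).2 (by simp))

lemma sum_eq_zero_of_prod_X_sub_C_eq {R ι : Type*} [CommRing R] [Nontrivial R] {σ : Multiset R}
    {T : Multiset ι} {p h : ℕ} (hh : 1 < h) {c : R} {f : ι → R}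
    (hprod : (σ.map (X - C ·)).prod =
      X ^ p * (X ^ h - C c) * (T.map fun i => X ^ h - C (f i)).prod) : σ.sum = 0 := by
  have hmon : ∀ c : R, (X ^ h - C c).Monic := fun c => monic_X_pow_sub_C c (by omega)
  have hT : (T.map fun i => X ^ h - C (f i)).prod.nextCoeff = 0 := by
    rw [Monic.nextCoeff_multiset_prod _ _ fun i _ => hmon (f i)]
    simp [nextCoeff_X_pow_sub_C hh]
  have hX : (X ^ p : R[X]).nextCoeff = 0 := by
    rw [Monic.nextCoeff_pow monic_X]
    simp [nextCoeff]
  have hnext := congrArg nextCoeff hprod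
  rw [multiset_prod_X_sub_C_nextCoeff, Monic.nextCoeff_mul ((monic_X_pow p).mul (hmon c))
    (monic_multiset_prod_of_monic _ _ fun i _ => hmon (f i)),
    Monic.nextCoeff_mul (monic_X_pow p) (hmon c), hX, hT, nextCoeff_X_pow_sub_C hh] at hnext
  simpa using hnext

lemma count_eq_one_of_prod_X_sub_C_eq {K : Type*} [NormedField K] [CharZero K] [DecidableEq K]
    {σ Z : Multiset K} {p h : ℕ} {r : K} (hr : r ≠ 0) (hh : h ≠ 0) (hZ : ∀ z ∈ Z, ‖z‖ < 1)
    (hprod : (σ.map (X - C ·)).prod =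
      X ^ p * (X ^ h - C (r ^ h)) * (Z.map fun z => X ^ h - C ((z * r) ^ h)).prod) :
    σ.count r = 1 := by
  have hX : (X ^ p : K[X]).rootMultiplicity r = 0 :=
    rootMultiplicity_eq_zero (by simp [IsRoot, hr])
  have hprodZ : (Z.map fun z => X ^ h - C ((z * r) ^ h)).prod.rootMultiplicity r = 0 := by
    refine rootMultiplicity_eq_zero fun hroot => ?_
    obtain ⟨z, hz, hzr⟩ : ∃ z ∈ Z, r ^ h - (z * r) ^ h = 0 := by
      simpa [IsRoot, eval_multiset_prod, Multiset.prod_eq_zero_iff] using hroot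
    have hz1 : ‖z‖ ^ h = 1 := by
      rw [← norm_pow, mul_right_cancel₀ (pow_ne_zero h hr)
        (by linear_combination -hzr : z ^ h * r ^ h = 1 * r ^ h), norm_one]
    exact (pow_lt_one₀ (norm_nonneg z) (hZ z hz) hh).ne hz1
  have hne : (σ.map (X - C ·)).prod ≠ 0 := (monic_multisetProd_X_sub_C σ).ne_zero
  have hmult := congrArg (rootMultiplicity r) hprod
  rw [hprod] at hne
  rwa [rootMultiplicity_mul hne, rootMultiplicity_mul (left_ne_zero_of_mul hne), hX, hprodZ,
    rootMultiplicity_X_pow_sub_C hh hr, ← count_roots, roots_multiset_prod_X_sub_C] at hmult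

lemma HasFrobeniusStructure.count_perronRoot {σ : Multiset ℂ} (h : HasFrobeniusStructure σ) :
    σ.count (perronRoot σ : ℂ) = 1 := by
  obtain ⟨-, -, -, -, hpos, k, p, Z, hk, hZ, hprod⟩ := h
  exact count_eq_one_of_prod_X_sub_C_eq (Complex.ofReal_ne_zero.2 hpos.ne') (by omega)
    (fun z hz => (hZ z hz).2) hprod

lemma HasFrobeniusStructure.sum_eq_zero {σ : Multiset ℂ} (h : HasFrobeniusStructure σ) :
    σ.sum = 0 := by
  obtain ⟨-, -, -, -, -, k, p, Z, hk, -, hprod⟩ := h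
  exact sum_eq_zero_of_prod_X_sub_C_eq hk hprod

end FrobeniusStructure

section Constructions

lemma det_fromBlocks_comm {m R : Type*} [Fintype m] [DecidableEq m] [CommRing R]
    (B C : Matrix m m R) : (fromBlocks B C C B).det = (B + C).det * (B - C).det := by
  have htriangular : fromBlocks 1 1 0 1 * fromBlocks B C C B * fromBlocks 1 (-1) 0 1 =
      fromBlocks (B + C) 0 C (B - C) := by
    rw [fromBlocks_multiply, fromBlocks_multiply]
    congr 1 <;> noncomm_ring
  have hdet := congrArg det htriangular
  rwa [det_mul, det_mul, det_fromBlocks_zero₂₁, det_fromBlocks_zero₂₁, det_fromBlocks_zero₁₂,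
    det_one, one_mul, one_mul, mul_one] at hdet

lemma charpoly_fromBlocks_comm {m R : Type*} [Fintype m] [DecidableEq m] [CommRing R]
    (B C : Matrix m m R) :
    (fromBlocks B C C B).charpoly = (B + C).charpoly * (B - C).charpoly := by
  rw [charpoly, charmatrix_fromBlocks, det_fromBlocks_comm]
  simp only [charpoly, charmatrix, RingHom.mapMatrix_apply, map_add, map_sub]
  congr 2 <;> abel

lemma charpoly_fin_two_eq_mul {R : Type*} [CommRing R] [Nontrivial R]
    {M : Matrix (Fin 2) (Fin 2) R} {a b : R} (htrace : M.trace = a + b) (hdet : M.det = a * b) :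
    M.charpoly = (X - C a) * (X - C b) := by
  rw [charpoly_fin_two, htrace, hdet, C_add, C_mul]
  ring

lemma forall_apply_fin_two {α : Type*} {P : α → Prop} {a b c d : α} :
    (∀ i j, P (!![a, b; c, d] i j)) ↔ (P a ∧ P b) ∧ P c ∧ P d := by
  simp [Fin.forall_fin_two]

lemma isIrreduciblyRealizable_of_charpoly_mul_eq {B C : Matrix (Fin 2) (Fin 2) ℝ}
    (hB : ∀ i j, 0 ≤ B i j) (hC : ∀ i j, 0 ≤ C i j) (hB01 : B 0 1 ≠ 0) (hC10 : C 1 0 ≠ 0)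
    {s : Multiset ℝ}
    (hs : (B + C).charpoly * (B - C).charpoly = (s.map fun t => X - Polynomial.C t).prod) :
    IsIrreduciblyRealizable (s.map (↑)) := by
  refine ⟨2 + 2, reindex finSumFinEquiv finSumFinEquiv (fromBlocks B C C B), fun i j => ?_,
    (isIndecomposable_of_apply_add_one_ne_zero fun i => ?_).not_isReducible,
    matrixSpectrum_eq_map_of_charpoly_eq ?_⟩
  · rw [reindex_apply, submatrix_apply]
    rcases finSumFinEquiv.symm i with i | i <;> rcases finSumFinEquiv.symm j with j | j
    exacts [hB i j, hC i j, hC i j, hB i j]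
  · fin_cases i
    exacts [hB01, hC10, hB01, hC10]
  · rw [charpoly_reindex, charpoly_fromBlocks_comm, hs]

lemma isIrreduciblyRealizable_of_abs_lt {a b c d : ℝ} (hb : |b| < a) (hc : |c| < a) (hd : |d| < a)
    (hcb : c ≤ b) (hdb : d ≤ b) (hsum : 0 ≤ a + b + c + d) :
    IsIrreduciblyRealizable (({a, b, c, d} : Multiset ℝ).map (↑)) := by
  rw [abs_lt] at hb hc hd
  obtain ⟨u, ⟨hbu, hdu⟩, hua, huc⟩ : ∃ u, (b < u ∧ -d ≤ u) ∧ u < a ∧ u ≤ a + b + c := by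
    refine ⟨(max b (-d) + min a (a + b + c)) / 2, ?_⟩
    grind
  -- Below, `B + C = !![u, e; 1, v]` with trace `a + b` and determinant `a * b`, and
  -- `B - C = diagonal ![d, c]`.
  obtain ⟨v, hv⟩ : ∃ v, v = a + b - u := ⟨_, rfl⟩
  obtain ⟨e, he⟩ : ∃ e, e = (u - b) * (a - u) := ⟨_, rfl⟩
  have he0 : 0 < e := he ▸ mul_pos (sub_pos.2 hbu) (sub_pos.2 hua)
  have hud : 0 ≤ (u + d) / 2 ∧ 0 ≤ (u - d) / 2 := ⟨by linarith, by linarith⟩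
  have hvc : 0 ≤ (v + c) / 2 ∧ 0 ≤ (v - c) / 2 := ⟨by linarith, by linarith⟩
  refine isIrreduciblyRealizable_of_charpoly_mul_eq
    (B := !![(u + d) / 2, e / 2; 1 / 2, (v + c) / 2])
    (C := !![(u - d) / 2, e / 2; 1 / 2, (v - c) / 2]) ?_ ?_ (half_pos he0).ne' one_half_pos.ne' ?_
  · simp only [forall_apply_fin_two, hud, hvc, (half_pos he0).le, one_half_pos.le, and_self]
  · simp only [forall_apply_fin_two, hud, hvc, (half_pos he0).le, one_half_pos.le, and_self]
  · rw [charpoly_fin_two_eq_mul (a := a) (b := b), charpoly_fin_two_eq_mul (a := c) (b := d)]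
    · simp [mul_assoc]
    all_goals
      simp only [of_add_of, of_sub_of, cons_add_cons, cons_sub_cons, empty_add_empty,
        empty_sub_empty, trace_fin_two_of, det_fin_two_of, hv, he]
      ring

lemma isIrreduciblyRealizable_symmetric {r a : ℝ} (h : |a| < r) :
    IsIrreduciblyRealizable (({r, -r, a, -a} : Multiset ℝ).map (↑)) := by
  have hadd : 0 < (r + a) / 2 := by linarith [(abs_lt.1 h).1]
  have hsub : 0 < (r - a) / 2 := by linarith [(abs_lt.1 h).2]
  refine isIrreduciblyRealizable_of_charpoly_mul_eq
    (B := !![0, (r + a) / 2; (r + a) / 2, 0]) (C := !![0, (r - a) / 2; (r - a) / 2, 0])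
    ?_ ?_ hadd.ne' hsub.ne' ?_
  · simp only [forall_apply_fin_two, hadd.le, le_refl, and_self]
  · simp only [forall_apply_fin_two, hsub.le, le_refl, and_self]
  · rw [charpoly_fin_two_eq_mul (a := r) (b := -r), charpoly_fin_two_eq_mul (a := a) (b := -a)]
    · simp [mul_assoc]
    all_goals
      simp only [of_add_of, of_sub_of, cons_add_cons, cons_sub_cons, empty_add_empty,
        empty_sub_empty, trace_fin_two_of, det_fin_two_of]
      ring

end Constructions

section RealLists

lemma exists_eq_symmetric_of_sum_eq_zero {K : Type*} [Field K] [LinearOrder K]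
    [IsStrictOrderedRing K] {s : Multiset K} {r : K} (hr : 0 < r) (hcard : s.card = 4)
    (hle : ∀ t ∈ s, |t| ≤ r) (hcount : s.count r = 1) (hneg : -r ∈ s) (hsum : s.sum = 0) :
    ∃ a, |a| < r ∧ s = {r, -r, a, -a} := by
  obtain ⟨τ, rfl⟩ := Multiset.exists_cons_of_mem (Multiset.one_le_count_iff_mem.1 hcount.ge)
  obtain ⟨υ, rfl⟩ := Multiset.exists_cons_of_mem
    ((Multiset.mem_cons.1 hneg).resolve_left (by linarith))
  obtain ⟨a, b, rfl⟩ := Multiset.card_eq_two.1 (by simpa using hcard : υ.card = 2)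
  obtain rfl : b = -a := by
    rw [Multiset.sum_cons, Multiset.sum_cons, Multiset.insert_eq_cons, Multiset.sum_cons,
      Multiset.sum_singleton] at hsum
    linarith
  have hra : r ≠ -r ∧ r ≠ a ∧ r ≠ -a := by
    rw [Multiset.count_cons_self, Nat.add_eq_right, Multiset.count_eq_zero] at hcount
    simpa using hcount
  refine ⟨a, (hle a (by simp)).lt_of_ne fun h => ?_, rfl⟩
  rcases (abs_eq hr.le).1 h with h | h
  · exact hra.2.1 h.symm
  · exact hra.2.2 (by rw [h, neg_neg])

lemma sum_map_ofReal (s : Multiset ℝ) : (s.map (↑)).sum = (s.sum : ℂ) :=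
  (map_multiset_sum Complex.ofRealHom s).symm

lemma count_map_ofReal (s : Multiset ℝ) (t : ℝ) : (s.map (↑)).count (t : ℂ) = s.count t :=
  Multiset.count_map_eq_count' _ _ Complex.ofReal_injective t

variable {s : Multiset ℝ}

lemma abs_le_perronRoot {t : ℝ} (ht : t ∈ s) : |t| ≤ perronRoot (s.map (↑)) := by
  simpa using norm_le_perronRoot (Multiset.mem_map_of_mem Complex.ofReal ht)

lemma exists_eq_symmetric_of_not_isSpectrallySimple (hcard : s.card = 4)
    (hcount : (s.map (↑)).count (perronRoot (s.map (↑)) : ℂ) = 1)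
    (hns : ¬ IsSpectrallySimple (s.map (↑))) (hsum : (s.map ((↑) : ℝ → ℂ)).sum = 0) :
    ∃ r a : ℝ, |a| < r ∧ s = {r, -r, a, -a} := by
  rw [isSpectrallySimple_iff, not_and] at hns
  have hnuniq := hns hcount
  have hr0 := perronRoot_nonneg (s.map (↑))
  have hle : ∀ t ∈ s, |t| ≤ _ := fun t => abs_le_perronRoot
  generalize perronRoot (s.map (↑)) = r at *
  rw [count_map_ofReal] at hcount
  rw [sum_map_ofReal, Complex.ofReal_eq_zero] at hsum
  obtain ⟨t, ht, htr, hne⟩ : ∃ t ∈ s, |t| = r ∧ t ≠ r := by simpa using hnuniq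
  obtain rfl : t = -r := ((abs_eq hr0).1 htr).resolve_left hne
  have hr : 0 < r := hr0.lt_of_ne fun h => hne (by rw [← h, neg_zero])
  exact ⟨r, exists_eq_symmetric_of_sum_eq_zero hr hcard hle hcount ht hsum⟩

lemma hasFrobeniusStructure_symmetric {r a : ℝ} (h : |a| < r) :
    HasFrobeniusStructure (({r, -r, a, -a} : Multiset ℝ).map (↑)) := by
  have hpos : 0 < r := (abs_nonneg a).trans_lt h
  have hρ : perronRoot (({r, -r, a, -a} : Multiset ℝ).map (↑)) = r :=
    perronRoot_eq_of_mem hpos.le (by simp) (by simp [abs_of_pos hpos, h.le])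
  rw [HasFrobeniusStructure, isSpectrallySimple_iff, hρ]
  refine ⟨by simp, by simp, by simp, fun hs => ?_, hpos, ?_⟩
  · have hneg : ((-r : ℝ) : ℂ) = r := hs.2 _ (by simp) (by simp [abs_of_pos hpos])
    linarith [Complex.ofReal_injective hneg]
  · rcases eq_or_ne a 0 with rfl | ha
    · refine ⟨2, 2, 0, one_lt_two, by simp, ?_⟩
      simp only [Multiset.insert_eq_cons, Multiset.map_cons, Multiset.map_singleton,
        Multiset.map_zero, Multiset.prod_cons, Multiset.prod_singleton, Multiset.prod_zero,
        Complex.ofReal_neg, Complex.ofReal_zero, C_neg, C_0, C_pow]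
      ring
    · have hrC : (r : ℂ) ≠ 0 := Complex.ofReal_ne_zero.2 hpos.ne'
      refine ⟨2, 0, {(a / r : ℂ)}, one_lt_two, ?_, ?_⟩
      · simp [ha, hpos.ne', abs_of_pos hpos, div_lt_one hpos, h]
      · rw [Multiset.map_singleton, Multiset.prod_singleton, div_mul_cancel₀ _ hrC]
        simp only [Multiset.insert_eq_cons, Multiset.map_cons, Multiset.map_singleton,
          Multiset.prod_cons, Multiset.prod_singleton, Complex.ofReal_neg, C_neg, C_pow]
        ring

lemma isIrreduciblyRealizable_of_isSpectrallySimple (hcard : s.card = 4) (hsum : 0 ≤ s.sum)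
    (h : IsSpectrallySimple (s.map (↑))) : IsIrreduciblyRealizable (s.map (↑)) := by
  obtain ⟨hcount, huniq⟩ := isSpectrallySimple_iff.1 h
  have hle : ∀ t ∈ s, |t| ≤ _ := fun t => abs_le_perronRoot
  generalize perronRoot (s.map (↑)) = r at *
  rw [count_map_ofReal] at hcount
  obtain ⟨τ, rfl⟩ := Multiset.exists_cons_of_mem (Multiset.one_le_count_iff_mem.1 hcount.ge)
  rw [Multiset.count_cons_self, Nat.add_eq_right, Multiset.count_eq_zero] at hcount
  have hlt : ∀ t ∈ τ, |t| < r := fun t ht => by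
    refine (hle t (Multiset.mem_cons_of_mem ht)).lt_of_ne fun htr => hcount ?_
    obtain rfl : t = r := by simpa [htr] using huniq t (by simp [ht])
    exact ht
  have hτ : τ ≠ 0 := by
    rintro rfl
    simp at hcard
  obtain ⟨b, hb, hmax⟩ := Multiset.exists_max_image id hτ
  obtain ⟨υ, rfl⟩ := Multiset.exists_cons_of_mem hb
  obtain ⟨c, d, rfl⟩ := Multiset.card_eq_two.1 (by simpa using hcard : υ.card = 2)
  exact isIrreduciblyRealizable_of_abs_lt (hlt b (by simp)) (hlt c (by simp)) (hlt d (by simp))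
    (hmax c (by simp)) (hmax d (by simp)) (by simpa [add_assoc] using hsum)

theorem isIrreduciblyRealizable_map_ofReal_iff (hcard : s.card = 4) (hsum : 0 ≤ s.sum) :
    IsIrreduciblyRealizable (s.map (↑)) ↔
      IsSpectrallySimple (s.map (↑)) ∨ HasFrobeniusStructure (s.map (↑)) := by
  have h0 : s.map ((↑) : ℝ → ℂ) ≠ 0 := by
    rw [← Multiset.card_pos, Multiset.card_map, hcard]
    exact Nat.succ_pos 3
  constructor
  · intro h
    obtain ⟨hcount, hzero⟩ := h.count_perronRoot_and_sum_eq_zero h0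
    refine or_iff_not_imp_left.2 fun hns => ?_
    obtain ⟨r, a, ha, rfl⟩ :=
      exists_eq_symmetric_of_not_isSpectrallySimple hcard hcount hns (hzero hns)
    exact hasFrobeniusStructure_symmetric ha
  · rintro (h | h)
    · exact isIrreduciblyRealizable_of_isSpectrallySimple hcard hsum h
    · obtain ⟨r, a, ha, rfl⟩ := exists_eq_symmetric_of_not_isSpectrallySimple hcard
        h.count_perronRoot h.2.2.2.1 h.sum_eq_zero
      exact isIrreduciblyRealizable_symmetric ha

end RealLists

end NIEP

theorem theorem20_general (σ : Multiset ℂ) (hcard : σ.card = 4) (hreal : ∀ z ∈ σ, z.im = 0)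
    (hsum : 0 ≤ σ.sum.re) :
    Xor (NIEP.IsIrreduciblyRealizable σ)
      (¬ NIEP.IsSpectrallySimple σ ∧ ¬ NIEP.HasFrobeniusStructure σ) := by
  lift σ to Multiset ℝ using hreal
  rw [Multiset.card_map] at hcard
  rw [NIEP.sum_map_ofReal, Complex.ofReal_re] at hsum
  rw [← not_or, xor_not_right]
  exact NIEP.isIrreduciblyRealizable_map_ofReal_iff hcard hsum

theorem theorem20 (σ : Multiset ℂ) (hcard : σ.card = 4) (hreal : ∀ z ∈ σ, z.im = 0)
    (hσ : NIEP.IsRealizable σ) :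
    Xor (NIEP.IsIrreduciblyRealizable σ)
      (¬ NIEP.IsSpectrallySimple σ ∧ ¬ NIEP.HasFrobeniusStructure σ) :=
  theorem20_general σ hcard hreal hσ.sum_re_nonneg
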